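/- Let $(c,b,A)$, with $c,b\in\mathbb R^s$ and $A=(a_{ij})\in\mathbb R^{s\times s}$, be the coefficients of an $s$-stage Runge–Kutta (RK) method. A step of size $h$ from $(t_0,y_0)$ of the RK method for $y'=f(t,y)$ is $$Y_i=y_0+h\sum_{j}a_{ij}f(t_0+c_jh,Y_j),\qquad y_1=y_0+h\sum_i b_if(t_0+c_ih,Y_i).$$ The special exponential integrator (SEI) built from $(c,b,A)$ is the exponential integrator for $y'=My+f(y)$ with coefficients $\bar a_{ij}(hM)=a_{ij}e^{(c_i-c_j)hM}$ and $\bar b_i(hM)=b_ie^{(1-c_i)hM}$, that is, $$Y_i=e^{c_ihM}y_0+h\sum_j a_{ij}e^{(c_i-c_j)hM}f(Y_j),\qquad y_1=e^{hM}y_0+h\sum_i b_ie^{(1-c_i)hM}f(Y_i).$$ Let $X$ be a real Banach space, e.g. $\mathbb R^d$; on $X$ we consider the problems $y'=f(t,y)$ with $f:\mathbb R\times X\to X$ analytic (RK), and $y'=My+f(y)$ with $M$ a bounded linear operator (a matrix if $X=\mathbb R^d$) and $f:X\to X$ analytic (SEI). A method is - *symmetric* on $X$ if for all such problems, all $h\in\mathbb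 R$ and all $y_0,y_1$ (and $t_0$): $y_1$ is obtained from $y_0$ by a step of size $h$ (starting at time $t_0$) if and only if $y_0$ is obtained from $y_1$ by a step of size $-h$ (starting at time $t_0+h$); - *of order* $p$ on $X$ if for all such problems with solution $y$, $y(t_0)=y_0$, the local error satisfies $y_1-y(t_0+h)=O(h^{p+1})$ as $h\to0^+$, where the stages $Y_i=Y_i(h)$ are those tending to $y_0$ as $h\to0^+$. On $\mathbb R^{2n}$ let $J=\begin{pmatrix}0&I\\-I&0\end{pmatrix}$. The RK method is *symplectic* on $\mathbb R^{2n}$ if for every smooth Hamiltonian system $y'=J^{-1}\nabla_yH(t,y)$, and the SEI is *symplectic* on $\mathbb R^{2n}$ if for every system $y'=My+J^{-1}\nabla U(y)$ with $M=J^{-1}Q$, $Q$ a symmetric matrix and $U$ smooth, the one-step map $\Phi:y_0\mapsto y_1$ satisfies $\Phi'(y)^{\top}J\,\Phi'(y)=J$ on every open set on which it is defined through stages that solve the stage equations and depend differentiably on $y_0$. **Theorem.** 1. If the RK method is symmetric on $X$, then the SEI is symmetric on $X$. 2. If the RK method is symplectic on $\mathbb R^{2n}$, then the SEI is symplectic on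 $\mathbb R^{2n}$. 3. If the RK method is symmetric and symplectic on $\mathbb R^{2n}$, then the SEI is symmetric and symplectic on $\mathbb R^{2n}$. 4. If the RK method is of order $p$ on $X$, then the SEI is of order $p$ on $X$. -/

import Mathlib

open scoped Topology

noncomputable section

namespace ExpInt

/-- The coefficients `(c, b, A)` of an `s`-stage Runge-Kutta method. -/
structure RKMethod (s : ℕ) where
  c : Fin s → ℝ
  b : Fin s → ℝ
  a : Fin s → Fin s → ℝ

/-- The coefficients of an `s`-stage exponential integrator on the space `E`: real nodes `c i` and
operator-valued functions `a i j`, `b i` of the operator `h M`. -/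
structure EIMethod (s : ℕ) (E : Type*) [NormedAddCommGroup E] [NormedSpace ℝ E] where
  c : Fin s → ℝ
  b : Fin s → (E →L[ℝ] E) → (E →L[ℝ] E)
  a : Fin s → Fin s → (E →L[ℝ] E) → (E →L[ℝ] E)

section Schemes

variable {s : ℕ} {E : Type*} [NormedAddCommGroup E] [NormedSpace ℝ E]

/-- Stage equations of a Runge-Kutta step of size `h` from `(t₀, y₀)` for `y' = f(t, y)`. -/
def RKMethod.Stages (R : RKMethod s) (f : ℝ → E → E) (t₀ h : ℝ) (y₀ : E) (Y : Fin s → E) : Prop :=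
  ∀ i, Y i = y₀ + h • ∑ j, R.a i j • f (t₀ + R.c j * h) (Y j)

/-- The update of a Runge-Kutta step, computed from the stages. -/
def RKMethod.update (R : RKMethod s) (f : ℝ → E → E) (t₀ h : ℝ) (y₀ : E) (Y : Fin s → E) : E :=
  y₀ + h • ∑ i, R.b i • f (t₀ + R.c i * h) (Y i)

/-- `y₁` is produced from `(t₀, y₀)` by one Runge-Kutta step of size `h` for `y' = f(t, y)`. -/
def RKMethod.Step (R : RKMethod s) (f : ℝ → E → E) (t₀ h : ℝ) (y₀ y₁ : E) : Prop :=
  ∃ Y : Fin s → E, R.Stages f t₀ h y₀ Y ∧ y₁ = R.update f t₀ h y₀ Y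

/-- Stage equations of a step of size `h` of an exponential integrator for `y' = M y + f(y)`. -/
def EIMethod.Stages (S : EIMethod s E) (M : E →L[ℝ] E) (f : E → E) (h : ℝ) (y₀ : E)
    (Y : Fin s → E) : Prop :=
  ∀ i, Y i = NormedSpace.exp (S.c i • h • M) y₀ + h • ∑ j, S.a i j (h • M) (f (Y j))

/-- The update of a step of an exponential integrator, computed from the stages. -/
def EIMethod.update (S : EIMethod s E) (M : E →L[ℝ] E) (f : E → E) (h : ℝ) (y₀ : E)
    (Y : Fin s → E) : E :=
  NormedSpace.exp (h • M) y₀ + h • ∑ i, S.b i (h • M) (f (Y i))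

/-- `y₁` is produced from `y₀` by one step of size `h` of an exponential integrator for
`y' = M y + f(y)`. -/
def EIMethod.Step (S : EIMethod s E) (M : E →L[ℝ] E) (f : E → E) (h : ℝ) (y₀ y₁ : E) : Prop :=
  ∃ Y : Fin s → E, S.Stages M f h y₀ Y ∧ y₁ = S.update M f h y₀ Y

/-- The special exponential integrator (SEI) on `E` built from a Runge-Kutta method. -/
def RKMethod.sei (R : RKMethod s) (E : Type*) [NormedAddCommGroup E] [NormedSpace ℝ E] :
    EIMethod s E where
  c := R.c
  b i Z := R.b i • NormedSpace.exp ((1 - R.c i) • Z)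
  a i j Z := R.a i j • NormedSpace.exp ((R.c i - R.c j) • Z)

/-- A Runge-Kutta method is symmetric on `E` if, for every analytic problem `y' = f(t, y)` on `E`,
exchanging `(t₀, y₀)` with `(t₁, y₁) = (t₀ + h, y₁)` and `h` with `-h` gives the same method. -/
def RKMethod.IsSymmetric (R : RKMethod s) (E : Type*) [NormedAddCommGroup E] [NormedSpace ℝ E] :
    Prop :=
  ∀ f : ℝ → E → E, AnalyticOnNhd ℝ (Function.uncurry f) Set.univ →
    ∀ (t₀ h : ℝ) (y₀ y₁ : E), R.Step f t₀ h y₀ y₁ ↔ R.Step f (t₀ + h) (-h) y₁ y₀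

/-- An exponential integrator is symmetric if, for every problem `y' = M y + f(y)` with `f`
analytic, exchanging `y₀` with `y₁` and `h` with `-h` gives the same method. -/
def EIMethod.IsSymmetric (S : EIMethod s E) : Prop :=
  ∀ (M : E →L[ℝ] E) (f : E → E), AnalyticOnNhd ℝ f Set.univ →
    ∀ (h : ℝ) (y₀ y₁ : E), S.Step M f h y₀ y₁ ↔ S.Step M f (-h) y₁ y₀

/-- A Runge-Kutta method has order (at least) `p` on `E` if, for every analytic problem
`y' = f(t, y)`, `y(t₀) = y₀` on `E` with solution `y`, the local error `y₁ - y(t₀ + h)` is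
`O(h ^ (p + 1))` as `h → 0`. As the stage equations may have spurious solutions, the stages `Y h`
are those that tend to `y₀` as `h → 0` (for small `h` they exist and are unique). -/
def RKMethod.HasOrder (R : RKMethod s) (E : Type*) [NormedAddCommGroup E] [NormedSpace ℝ E]
    (p : ℕ) : Prop :=
  ∀ f : ℝ → E → E, AnalyticOnNhd ℝ (Function.uncurry f) Set.univ →
    ∀ (t₀ : ℝ) (y₀ : E) (y : ℝ → E), y t₀ = y₀ →
      (∀ᶠ t in 𝓝 t₀, HasDerivAt y (f t (y t)) t) →
      ∀ Y : ℝ → Fin s → E, (∀ᶠ h in 𝓝[>] (0 : ℝ), R.Stages f t₀ h y₀ (Y h)) →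
        Filter.Tendsto Y (𝓝[>] (0 : ℝ)) (𝓝 fun _ => y₀) →
        (fun h => R.update f t₀ h y₀ (Y h) - y (t₀ + h)) =O[𝓝[>] (0 : ℝ)] fun h => h ^ (p + 1)

/-- An exponential integrator has order (at least) `p` if, for every problem `y' = M y + f(y)`,
`y(t₀) = y₀` with `f` analytic and with solution `y`, the local error `y₁ - y(t₀ + h)` is
`O(h ^ (p + 1))` as `h → 0`; the stages are chosen as in `RKMethod.HasOrder`. -/
def EIMethod.HasOrder (S : EIMethod s E) (p : ℕ) : Prop :=
  ∀ (M : E →L[ℝ] E) (f : E → E), AnalyticOnNhd ℝ f Set.univ →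
    ∀ (t₀ : ℝ) (y₀ : E) (y : ℝ → E), y t₀ = y₀ →
      (∀ᶠ t in 𝓝 t₀, HasDerivAt y (M (y t) + f (y t)) t) →
      ∀ Y : ℝ → Fin s → E, (∀ᶠ h in 𝓝[>] (0 : ℝ), S.Stages M f h y₀ (Y h)) →
        Filter.Tendsto Y (𝓝[>] (0 : ℝ)) (𝓝 fun _ => y₀) →
        (fun h => S.update M f h y₀ (Y h) - y (t₀ + h)) =O[𝓝[>] (0 : ℝ)] fun h => h ^ (p + 1)

end Schemes

section Symplectic

/-- The phase space `ℝ²ⁿ`. -/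
abbrev Phase (n : ℕ) : Type := EuclideanSpace ℝ (Fin n ⊕ Fin n)

/-- The matrix `J = (0 I; -I 0)`. -/
def J (n : ℕ) : Matrix (Fin n ⊕ Fin n) (Fin n ⊕ Fin n) ℝ :=
  Matrix.fromBlocks 0 1 (-1) 0

/-- A matrix as a linear operator on `ℝ²ⁿ`. -/
def op {n : ℕ} (A : Matrix (Fin n ⊕ Fin n) (Fin n ⊕ Fin n) ℝ) : Phase n →L[ℝ] Phase n :=
  Matrix.toEuclideanCLM (𝕜 := ℝ) A

/-- The Hamiltonian vector field `J⁻¹ ∇H`. -/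
def hamVF {n : ℕ} (H : Phase n → ℝ) (y : Phase n) : Phase n :=
  op (J n)⁻¹ (gradient H y)

/-- `Φ` is differentiable on `D` with `Φ'(y)ᵀ J Φ'(y) = J` for every `y ∈ D`. -/
def IsSymplecticMapOn {n : ℕ} (Φ : Phase n → Phase n) (D : Set (Phase n)) : Prop :=
  DifferentiableOn ℝ Φ D ∧ ∀ y ∈ D, ∀ v w : Phase n,
    inner ℝ (fderiv ℝ Φ y v) (op (J n) (fderiv ℝ Φ y w)) = inner ℝ v (op (J n) w)

variable {s : ℕ} {n : ℕ}

/-- A Runge-Kutta method is symplectic on `ℝ²ⁿ` if, applied to any smooth Hamiltonian system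
`y' = J⁻¹ ∇H(t, y)`, its one-step map `y₀ ↦ y₁` is symplectic, wherever on an open set `D` it is
defined through a differentiable solution `Y` of the stage equations. -/
def RKMethod.IsSymplectic (R : RKMethod s) (n : ℕ) : Prop :=
  ∀ H : ℝ → Phase n → ℝ, ContDiff ℝ ((⊤ : ℕ∞) : WithTop ℕ∞) (Function.uncurry H) →
    ∀ (t₀ h : ℝ) (D : Set (Phase n)) (Y : Phase n → Fin s → Phase n), IsOpen D →
      DifferentiableOn ℝ Y D →
      (∀ y ∈ D, R.Stages (fun t => hamVF (H t)) t₀ h y (Y y)) →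
      IsSymplecticMapOn (fun y => R.update (fun t => hamVF (H t)) t₀ h y (Y y)) D

/-- An exponential integrator is symplectic if, applied to any Hamiltonian system
`y' = M y + J⁻¹ ∇U(y)` with `M = J⁻¹ Q`, `Q` a symmetric matrix and `U` smooth, its one-step map
`y₀ ↦ y₁` is symplectic, wherever on an open set `D` it is defined through a differentiable
solution `Y` of the stage equations. -/
def EIMethod.IsSymplectic (S : EIMethod s (Phase n)) : Prop :=
  ∀ Q : Matrix (Fin n ⊕ Fin n) (Fin n ⊕ Fin n) ℝ, Q.IsSymm →
    ∀ U : Phase n → ℝ, ContDiff ℝ ((⊤ : ℕ∞) : WithTop ℕ∞) U →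
    ∀ (h : ℝ) (D : Set (Phase n)) (Y : Phase n → Fin s → Phase n), IsOpen D →
      DifferentiableOn ℝ Y D →
      (∀ y ∈ D, S.Stages (op ((J n)⁻¹ * Q)) (hamVF U) h y (Y y)) →
      IsSymplecticMapOn (fun y => S.update (op ((J n)⁻¹ * Q)) (hamVF U) h y (Y y)) D

end Symplectic

end ExpInt

end

/-! The integrating factor `w(t) = e^{-tM} y(t)` turns `y' = M y + f(y)` into the nonautonomous
problem `w' = g(t, w)` with `g = lawsonField M f`. The SEI is the RK method applied to this problem
and transported back by `e^{tM}`: its coefficients `e^{(c_i-c_j)hM}` are exactly what the change of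
variables produces (`sei_stages_iff`, `sei_update_eq`). Each property then passes from RK to SEI
because the transformation respects it: `g` is analytic when `f` is, `e^{tM}` is invertible and
locally bounded in `t`, and for `M = J⁻¹Q` with `Q` symmetric it is symplectic, so that `g` is again
Hamiltonian (`hamVF_comp_flow`). -/

namespace ExpInt

/-! ### Integrating factor; symmetry and order -/

section Lawson

variable {s : ℕ} {E : Type*} [NormedAddCommGroup E] [NormedSpace ℝ E]

/-- The flow `t ↦ e^{tM}` of the linear equation `y' = M y`. -/
noncomputable def flow (M : E →L[ℝ] E) (t : ℝ) : E →L[ℝ] E := NormedSpace.exp (t • M)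

/-- The vector field `g(t, w) = e^{-tM} f(e^{tM} w)` solved by `w(t) = e^{-tM} y(t)` when
`y' = M y + f(y)`. -/
noncomputable def lawsonField (M : E →L[ℝ] E) (f : E → E) (t : ℝ) (w : E) : E :=
  flow M (-t) (f (flow M t w))

@[simp]
theorem flow_zero (M : E →L[ℝ] E) : flow M 0 = 1 := by
  simp [flow]

variable [CompleteSpace E]

theorem flow_add (M : E →L[ℝ] E) (a b : ℝ) : flow M (a + b) = flow M a * flow M b := by
  let _ : NormedAlgebra ℚ (E →L[ℝ] E) := NormedAlgebra.restrictScalars ℚ ℝ (E →L[ℝ] E)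
  rw [flow, add_smul]
  exact NormedSpace.exp_add_of_commute (((Commute.refl M).smul_left a).smul_right b)

theorem flow_flow (M : E →L[ℝ] E) (a b : ℝ) (x : E) :
    flow M a (flow M b x) = flow M (a + b) x := by
  rw [flow_add]; rfl

@[simp]
theorem flow_neg_flow (M : E →L[ℝ] E) (a : ℝ) (x : E) : flow M (-a) (flow M a x) = x := by
  rw [flow_flow]; simp

@[simp]
theorem flow_flow_neg (M : E →L[ℝ] E) (a : ℝ) (x : E) : flow M a (flow M (-a) x) = x := by
  rw [flow_flow]; simp

theorem flow_injective (M : E →L[ℝ] E) (a : ℝ) : Function.Injective (flow M a) :=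
  Function.LeftInverse.injective (flow_neg_flow M a)

theorem hasDerivAt_flow (M : E →L[ℝ] E) (t : ℝ) : HasDerivAt (flow M) (flow M t * M) t :=
  hasDerivAt_exp_smul_const M t

theorem continuous_flow (M : E →L[ℝ] E) : Continuous (flow M) :=
  continuous_iff_continuousAt.2 fun t => (hasDerivAt_flow M t).continuousAt

theorem analyticAt_flow (M : E →L[ℝ] E) (t : ℝ) : AnalyticAt ℝ (flow M) t :=
  AnalyticAt.fun_comp (f := fun t : ℝ => t • M) (NormedSpace.exp_analytic (𝕂 := ℝ) (t • M))
    (analyticAt_id.fun_smul analyticAt_const)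

theorem analyticAt_flow_apply (M : E →L[ℝ] E) (p : ℝ × E) :
    AnalyticAt ℝ (fun q : ℝ × E => flow M q.1 q.2) p :=
  ((ContinuousLinearMap.id ℝ (E →L[ℝ] E)).analyticAt_bilinear (flow M p.1, p.2)).fun_comp
    (f := fun q : ℝ × E => (flow M q.1, q.2))
    (((analyticAt_flow M p.1).fun_comp (f := fun q : ℝ × E => q.1) analyticAt_fst).prod
      analyticAt_snd)

/-- Makes `lawsonField M f` an admissible problem for the RK symmetry and order hypotheses, which
concern analytic fields only. -/
theorem analyticOnNhd_lawsonField (M : E →L[ℝ] E) {f : E → E} (hf : AnalyticOnNhd ℝ f Set.univ) :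
    AnalyticOnNhd ℝ (Function.uncurry (lawsonField M f)) Set.univ := by
  intro p _
  have hf' : AnalyticAt ℝ (fun q : ℝ × E => f (flow M q.1 q.2)) p :=
    (hf _ (Set.mem_univ _)).fun_comp (f := fun q : ℝ × E => flow M q.1 q.2)
      (analyticAt_flow_apply M p)
  exact (analyticAt_flow_apply M (-p.1, f (flow M p.1 p.2))).fun_comp
    (f := fun q : ℝ × E => (-q.1, f (flow M q.1 q.2))) (analyticAt_fst.fun_neg.prod hf')

/-- The stages of the SEI are the stages of the Runge-Kutta method for the transformed problem,
transported by the linear flow. -/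
theorem sei_stages_iff (R : RKMethod s) (M : E →L[ℝ] E) (f : E → E) (t₀ h : ℝ) (y₀ : E)
    (Y : Fin s → E) :
    (R.sei E).Stages M f h y₀ Y ↔
      R.Stages (lawsonField M f) t₀ h (flow M (-t₀) y₀)
        fun i => flow M (-(t₀ + R.c i * h)) (Y i) := by
  refine forall_congr' fun i => ?_
  rw [← (flow_injective M (-(t₀ + R.c i * h))).eq_iff]
  have h₁ : NormedSpace.exp ((R.sei E).c i • h • M) = flow M (R.c i * h) := by
    simp [flow, RKMethod.sei, smul_smul]
  have h₂ : ∀ j, (R.sei E).a i j (h • M) = R.a i j • flow M ((R.c i - R.c j) * h) := by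
    simp [flow, RKMethod.sei, smul_smul]
  simp only [h₁, h₂, lawsonField, map_add, map_smul, map_sum, flow_flow_neg, smul_apply]
  -- The exponents telescope: `-(t₀ + c_i h) + (c_i - c_j) h = -(t₀ + c_j h)`.
  simp only [flow_flow]
  ring_nf

/-- The update of the SEI is the Runge-Kutta update for the transformed problem, transported by the
linear flow. -/
theorem sei_update_eq (R : RKMethod s) (M : E →L[ℝ] E) (f : E → E) (t₀ h : ℝ) (y₀ : E)
    (Y : Fin s → E) :
    (R.sei E).update M f h y₀ Y =
      flow M (t₀ + h) (R.update (lawsonField M f) t₀ h (flow M (-t₀) y₀)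
        fun i => flow M (-(t₀ + R.c i * h)) (Y i)) := by
  have h₁ : NormedSpace.exp (h • M) = flow M h := rfl
  have h₂ : ∀ j, (R.sei E).b j (h • M) = R.b j • flow M (h - h * R.c j) := by
    simp [flow, RKMethod.sei, smul_smul, mul_comm, mul_sub]
  simp only [EIMethod.update, RKMethod.update, h₁, h₂, lawsonField, map_add, map_smul, map_sum,
    flow_flow_neg, smul_apply]
  simp only [flow_flow]
  ring_nf

/-- The SEI does not see `t₀`, so the base time of the transformation is free; symmetry exploits
this. -/
theorem sei_step_iff (R : RKMethod s) (M : E →L[ℝ] E) (f : E → E) (t₀ h : ℝ) (y₀ y₁ : E) :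
    (R.sei E).Step M f h y₀ y₁ ↔
      R.Step (lawsonField M f) t₀ h (flow M (-t₀) y₀) (flow M (-(t₀ + h)) y₁) := by
  constructor
  · rintro ⟨Y, hY, rfl⟩
    refine ⟨_, (sei_stages_iff R M f t₀ h y₀ Y).1 hY, ?_⟩
    rw [sei_update_eq R M f t₀, flow_neg_flow]
  · rintro ⟨W, hW, hy⟩
    have hWY : W = fun i => flow M (-(t₀ + R.c i * h)) (flow M (t₀ + R.c i * h) (W i)) := by
      simp only [flow_neg_flow]
    refine ⟨fun i => flow M (t₀ + R.c i * h) (W i), ?_, ?_⟩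
    · rwa [sei_stages_iff R M f t₀, ← hWY]
    · rw [sei_update_eq R M f t₀, ← hWY, ← hy, flow_flow_neg]

theorem RKMethod.IsSymmetric.sei {R : RKMethod s} (hR : R.IsSymmetric E) :
    (R.sei E).IsSymmetric := by
  intro M f hf h y₀ y₁
  -- The forward step is based at time `0` and the backward step at time `h`, matching the time
  -- shift in RK symmetry.
  rw [sei_step_iff R M f 0 h, sei_step_iff R M f h (-h),
    hR _ (analyticOnNhd_lawsonField M hf)]
  simp

theorem hasDerivAt_flow_neg_apply {M : E →L[ℝ] E} {f : E → E} {y : ℝ → E} {t : ℝ}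
    (hy : HasDerivAt y (M (y t) + f (y t)) t) :
    HasDerivAt (fun t => flow M (-t) (y t)) (lawsonField M f t (flow M (-t) (y t))) t := by
  have h₁ : HasDerivAt (fun t => flow M (-t)) (-(flow M (-t) * M)) t := by
    have h := (hasDerivAt_flow M (-t)).scomp t (hasDerivAt_neg t)
    rw [neg_one_smul] at h
    exact h
  convert h₁.clm_apply hy using 1
  simp [lawsonField]

theorem RKMethod.HasOrder.sei {R : RKMethod s} {p : ℕ} (hR : R.HasOrder E p) :
    (R.sei E).HasOrder p := by
  intro M f hf t₀ y₀ y hy₀ hy Y hY hYlim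
  have hlim : Filter.Tendsto (fun h i => flow M (-(t₀ + R.c i * h)) (Y h i)) (𝓝[>] (0 : ℝ))
      (𝓝 fun _ => flow M (-t₀) y₀) := by
    refine tendsto_pi_nhds.2 fun i => ?_
    have hc : Continuous fun h : ℝ => flow M (-(t₀ + R.c i * h)) :=
      (continuous_flow M).comp (by fun_prop)
    have h₁ : Filter.Tendsto (fun h : ℝ => flow M (-(t₀ + R.c i * h))) (𝓝[>] 0)
        (𝓝 (flow M (-t₀))) := by
      simpa using (hc.tendsto 0).mono_left nhdsWithin_le_nhds
    exact (isBoundedBilinearMap_apply.continuous.tendsto (flow M (-t₀), y₀)).comp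
      (h₁.prodMk_nhds (tendsto_pi_nhds.1 hYlim i))
  have hO := hR _ (analyticOnNhd_lawsonField M hf) t₀ (flow M (-t₀) y₀)
    (fun t => flow M (-t) (y t)) (by simp [hy₀])
    (hy.mono fun t ht => hasDerivAt_flow_neg_apply ht) _
    (hY.mono fun h hh => (sei_stages_iff R M f t₀ h y₀ (Y h)).1 hh) hlim
  have hc : Continuous fun h : ℝ => flow M (t₀ + h) := (continuous_flow M).comp (by fun_prop)
  -- Transporting back multiplies the local error by an operator bounded as `h → 0⁺`, so the order
  -- is kept.
  have hbdd : (fun h : ℝ => ‖flow M (t₀ + h)‖) =O[𝓝[>] (0 : ℝ)] fun _ => (1 : ℝ) :=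
    (((hc.tendsto 0).mono_left nhdsWithin_le_nhds).isBigO_one ℝ).norm_left
  have hmul := hbdd.mul hO.norm_left
  simp only [one_mul] at hmul
  refine Asymptotics.IsBigO.trans (Asymptotics.isBigO_of_le _ fun h => ?_) hmul
  have key : (R.sei E).update M f h y₀ (Y h) - y (t₀ + h) =
      flow M (t₀ + h) (R.update (lawsonField M f) t₀ h (flow M (-t₀) y₀)
        (fun i => flow M (-(t₀ + R.c i * h)) (Y h i)) - flow M (-(t₀ + h)) (y (t₀ + h))) := by
    rw [map_sub, flow_flow_neg, sei_update_eq R M f t₀]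
  rw [key]
  exact (ContinuousLinearMap.le_opNorm _ _).trans (Real.le_norm_self _)

end Lawson

/-! ### Linear flows preserving a bilinear form -/

section Adjoint

variable {F : Type*} [NormedAddCommGroup F] [InnerProductSpace ℝ F] [CompleteSpace F]

/-- If `Mᵀ K = -K M`, then `(e^{tM})ᵀ K = K e^{-tM}`. -/
theorem star_flow_mul {K M : F →L[ℝ] F} (hM : star M * K = -(K * M)) (t : ℝ) :
    star (flow M t) * K = K * flow M (-t) := by
  let _ : NormedAlgebra ℚ (F →L[ℝ] F) := NormedAlgebra.restrictScalars ℚ ℝ (F →L[ℝ] F)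
  -- `K` intertwines `-tM` with `(tM)ᵀ`, and exponentials inherit this relation.
  have hsemi : SemiconjBy K ((-t) • M) (star (t • M)) := by
    rw [SemiconjBy, star_smul, star_trivial, smul_mul_assoc, hM, mul_smul_comm, neg_smul, smul_neg]
  rw [flow, flow, NormedSpace.star_exp]
  exact hsemi.exp_right.eq.symm

theorem mul_star_flow {K M : F →L[ℝ] F} (hK : K * K = -1) (hM : star M * K = -(K * M)) (t : ℝ) :
    K * star (flow M t) = flow M (-t) * K := by
  calc K * star (flow M t) = -(K * (star (flow M t) * K) * K) := by
        rw [mul_assoc, mul_assoc, hK, mul_neg, mul_neg, neg_neg, mul_one]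
    _ = flow M (-t) * K := by
        rw [star_flow_mul hM, ← mul_assoc, hK, neg_mul, neg_mul, one_mul, neg_neg]

/-- With `K = J` this is the symplecticity of the linear flow. -/
theorem inner_flow_flow {K M : F →L[ℝ] F} (hM : star M * K = -(K * M)) (t : ℝ) (v w : F) :
    inner ℝ (flow M t v) (K (flow M t w)) = inner ℝ v (K w) := by
  have h := DFunLike.congr_fun (star_flow_mul hM t) (flow M t w)
  simp only [mul_apply_eq_comp, flow_neg_flow] at h
  rw [← ContinuousLinearMap.adjoint_inner_right, ← ContinuousLinearMap.star_eq_adjoint, h]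

theorem gradient_comp_clm {U : F → ℝ} (A : F →L[ℝ] F) {w : F}
    (hU : DifferentiableAt ℝ U (A w)) :
    gradient (fun x => U (A x)) w = ContinuousLinearMap.adjoint A (gradient U (A w)) := by
  refine HasGradientAt.gradient ?_
  rw [hasGradientAt_iff_hasFDerivAt]
  have h := hU.hasGradientAt.hasFDerivAt.comp w A.hasFDerivAt
  have hA : InnerProductSpace.toDual ℝ F (ContinuousLinearMap.adjoint A (gradient U (A w))) =
      InnerProductSpace.toDual ℝ F (gradient U (A w)) ∘L A := by
    ext v
    simp only [ContinuousLinearMap.comp_apply, InnerProductSpace.toDual_apply_apply,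
      ContinuousLinearMap.adjoint_inner_left]
  rw [hA]
  exact h

end Adjoint

/-! ### Hamiltonian structure and symplecticity -/

section Symplectic

variable {s n : ℕ}

/-- `Matrix.J` has the opposite sign convention. -/
theorem J_eq_neg_matrix_J (n : ℕ) : J n = -Matrix.J (Fin n) ℝ := by
  simp [J, Matrix.J, Matrix.fromBlocks_neg]

theorem J_inv (n : ℕ) : (J n)⁻¹ = -J n := by
  refine Matrix.inv_eq_right_inv ?_
  rw [J_eq_neg_matrix_J, neg_neg, neg_mul, Matrix.J_squared, neg_neg]

theorem J_mul_J (n : ℕ) : J n * J n = -1 := by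
  rw [J_eq_neg_matrix_J, neg_mul_neg, Matrix.J_squared]

theorem J_transpose (n : ℕ) : (J n).transpose = -J n := by
  rw [J_eq_neg_matrix_J, Matrix.transpose_neg, Matrix.J_transpose]

theorem op_mul (A B : Matrix (Fin n ⊕ Fin n) (Fin n ⊕ Fin n) ℝ) : op (A * B) = op A * op B :=
  map_mul _ _ _

theorem op_neg (A : Matrix (Fin n ⊕ Fin n) (Fin n ⊕ Fin n) ℝ) : op (-A) = -op A :=
  map_neg _ _

theorem star_op (A : Matrix (Fin n ⊕ Fin n) (Fin n ⊕ Fin n) ℝ) : star (op A) = op A.transpose := by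
  rw [← Matrix.conjTranspose_eq_transpose_of_trivial]
  exact (map_star (Matrix.toEuclideanCLM (n := Fin n ⊕ Fin n) (𝕜 := ℝ)) A).symm

theorem op_J_mul_op_J (n : ℕ) : op (J n) * op (J n) = -1 := by
  rw [← op_mul, J_mul_J, op_neg, op, map_one]

/-- `J⁻¹Q` is a Hamiltonian matrix, that is, infinitesimally symplectic. -/
theorem star_op_mul_op_J {Q : Matrix (Fin n ⊕ Fin n) (Fin n ⊕ Fin n) ℝ} (hQ : Q.IsSymm) :
    star (op ((J n)⁻¹ * Q)) * op (J n) = -(op (J n) * op ((J n)⁻¹ * Q)) := by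
  rw [star_op, ← op_mul, ← op_mul, ← op_neg]
  congr 1
  rw [Matrix.transpose_mul, J_inv, Matrix.transpose_neg, J_transpose, hQ.eq, neg_neg, mul_assoc,
    J_mul_J, neg_mul, mul_neg, mul_neg, neg_neg, ← mul_assoc, J_mul_J, neg_mul, mul_one, one_mul]

/-- The transformed field of a Hamiltonian system is Hamiltonian, with `H(t, w) = U(e^{tM} w)`. -/
theorem hamVF_comp_flow {Q : Matrix (Fin n ⊕ Fin n) (Fin n ⊕ Fin n) ℝ} (hQ : Q.IsSymm)
    {U : Phase n → ℝ} (hU : Differentiable ℝ U) (t : ℝ) :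
    hamVF (fun w => U (flow (op ((J n)⁻¹ * Q)) t w)) =
      lawsonField (op ((J n)⁻¹ * Q)) (hamVF U) t := by
  funext w
  -- The chain rule puts `(e^{tM})ᵀ` in front of `∇U`; moving `J` past it leaves `e^{-tM}`, as in
  -- `lawsonField`.
  have key := DFunLike.congr_fun
    (mul_star_flow (op_J_mul_op_J n) (star_op_mul_op_J hQ) t)
    (gradient U (flow (op ((J n)⁻¹ * Q)) t w))
  rw [hamVF, gradient_comp_clm _ hU.differentiableAt, lawsonField, hamVF,
    ← ContinuousLinearMap.star_eq_adjoint, (J_inv n ▸ op_neg (J n) : op (J n)⁻¹ = -op (J n)),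
    neg_apply, neg_apply, map_neg, neg_inj]
  exact key

theorem RKMethod.IsSymplectic.sei {R : RKMethod s} (hR : R.IsSymplectic n) :
    (R.sei (Phase n)).IsSymplectic := by
  intro Q hQ U hU h D Y hD hYd hY
  set M := op ((J n)⁻¹ * Q)
  have hfield : (fun t => hamVF fun w => U (flow M t w)) = lawsonField M (hamVF U) :=
    funext fun t => hamVF_comp_flow hQ (hU.differentiable (by simp)) t
  have hH : ContDiff ℝ ((⊤ : ℕ∞) : WithTop ℕ∞)
      (Function.uncurry fun (t : ℝ) w => U (flow M t w)) :=
    hU.comp (contDiff_iff_contDiffAt.2 fun p => (analyticAt_flow_apply M p).contDiffAt)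
  have hW : DifferentiableOn ℝ (fun y i => flow M (-(0 + R.c i * h)) (Y y i)) D :=
    differentiableOn_pi.2 fun i =>
      (flow M _).differentiable.comp_differentiableOn (differentiableOn_pi.1 hYd i)
  -- At base time `0` the initial value is not transformed, so the RK map `Ψ` lives on the same `D`,
  -- and the SEI map is `e^{hM} ∘ Ψ`, a composition of symplectic maps.
  have hsymp := hR _ hH 0 h D _ hD hW fun y hy => by
    rw [hfield]
    simpa using (sei_stages_iff R M (hamVF U) 0 h y (Y y)).1 (hY y hy)
  rw [hfield] at hsymp
  set Ψ := fun y => R.update (lawsonField M (hamVF U)) 0 h y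
    fun i => flow M (-(0 + R.c i * h)) (Y y i) with hΨ
  have hupd : (fun y => (R.sei (Phase n)).update M (hamVF U) h y (Y y)) =
      fun y => flow M h (Ψ y) := by
    funext y
    simpa [hΨ] using sei_update_eq R M (hamVF U) 0 h y (Y y)
  rw [hupd]
  refine ⟨(flow M h).differentiable.comp_differentiableOn hsymp.1, fun y hy v w => ?_⟩
  have hd : HasFDerivAt (fun y => flow M h (Ψ y)) (flow M h ∘L fderiv ℝ Ψ y) y :=
    (flow M h).hasFDerivAt.comp y (hsymp.1.differentiableAt (hD.mem_nhds hy)).hasFDerivAt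
  rw [hd.fderiv, ContinuousLinearMap.comp_apply, ContinuousLinearMap.comp_apply,
    inner_flow_flow (star_op_mul_op_J hQ), hsymp.2 y hy]

end Symplectic

end ExpInt

theorem mainTheorem2 {s : ℕ} (R : ExpInt.RKMethod s) :
    (∀ (E : Type*) [NormedAddCommGroup E] [NormedSpace ℝ E] [CompleteSpace E],
      R.IsSymmetric E → (R.sei E).IsSymmetric) ∧
    (∀ n : ℕ, R.IsSymplectic n → (R.sei (ExpInt.Phase n)).IsSymplectic) ∧
    (∀ n : ℕ, R.IsSymmetric (ExpInt.Phase n) ∧ R.IsSymplectic n →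
      (R.sei (ExpInt.Phase n)).IsSymmetric ∧ (R.sei (ExpInt.Phase n)).IsSymplectic) ∧
    (∀ (E : Type*) [NormedAddCommGroup E] [NormedSpace ℝ E] [CompleteSpace E] (p : ℕ),
      R.HasOrder E p → (R.sei E).HasOrder p) := by
  exact ⟨fun E _ _ _ hR => hR.sei, fun n hR => hR.sei, fun n hR => ⟨hR.1.sei, hR.2.sei⟩,
    fun E _ _ _ p hR => hR.sei⟩
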